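/- Let $A_1,\dots,A_m\in\mathbb R^{n\times n}$ and $a_1,\dots,a_m\in\mathbb R^n$, and let $f=(f_1,\dots,f_m):\mathbb R^n\to\mathbb R^m$ be the quadratic map with $f_i(x)=\tfrac12x^TA_ix+a_i^Tx$. Put $A=[a_1~\dots~a_m]\in\mathbb R^{n\times m}$, $$\nu=\sigma_{\min}(A)=\sqrt{\lambda_{\min}(A^TA)},\qquad L_{\rm new}=\sqrt{\lambda_{\max}\Big(\sum_{i=1}^mA_i^TA_i\Big)},\qquad \epsilon^*_{\rm new}=\frac{\nu}{2L_{\rm new}},$$ where $\lambda_{\min}$ and $\lambda_{\max}$ denote the smallest and the largest eigenvalue of a symmetric matrix, and where $\epsilon^*_{\rm new}=+\infty$ if $L_{\rm new}=0<\nu$ and $\epsilon^*_{\rm new}=0$ if $L_{\rm new}=\nu=0$. Let $\|\cdot\|$ be the Euclidean norm. Then for every real $\epsilon$ with $0<\epsilon<\epsilon^*_{\rm new}$ and every $a\in\mathbb R^n$ with $\|a\|<2(\epsilon^*_{\rm new}-\epsilon)$, the image $$F_m(\epsilon,a)=\{f(x):x\in\mathbb R^n,\ \|x-a\|\le\epsilon\}$$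 is a convex subset of $\mathbb R^m$. -/

import Mathlib

open scoped Matrix ENNReal

noncomputable section

namespace QuadMap

/-- The largest real eigenvalue of a real square matrix (used for symmetric matrices only,
where the spectrum is a finite set of reals, nonempty in positive dimension). -/
def lambdaMax {k : ℕ} (M : Matrix (Fin k) (Fin k) ℝ) : ℝ := sSup (spectrum ℝ M)

/-- The smallest real eigenvalue of a real square matrix (used for symmetric matrices only). -/
def lambdaMin {k : ℕ} (M : Matrix (Fin k) (Fin k) ℝ) : ℝ := sInf (spectrum ℝ M)

/-- The smallest singular value `√(λ_min(BᵀB))` of an `n × m` matrix `B`. -/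
def sigmaMin {n m : ℕ} (B : Matrix (Fin n) (Fin m) ℝ) : ℝ := √(lambdaMin (Bᵀ * B))

/-- The quadratic map `f = (f_1, …, f_m)` with `f_i(x) = ½ xᵀ A_i x + a_iᵀ x`. -/
def quadMap {n m : ℕ} (A : Fin m → Matrix (Fin n) (Fin n) ℝ)
    (b : Fin m → EuclideanSpace ℝ (Fin n)) (x : EuclideanSpace ℝ (Fin n)) :
    EuclideanSpace ℝ (Fin m) :=
  WithLp.toLp 2 fun i => (1 / 2 : ℝ) * (x.ofLp ⬝ᵥ (A i *ᵥ x.ofLp)) + (b i).ofLp ⬝ᵥ x.ofLp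

/-- The `n × m` matrix `[a_1 … a_m]` with columns `a_i`. -/
def linearPart {n m : ℕ} (b : Fin m → EuclideanSpace ℝ (Fin n)) : Matrix (Fin n) (Fin m) ℝ :=
  Matrix.of fun j i => b i j

/-- `ν = σ_min([a_1 … a_m])`. -/
def nu {n m : ℕ} (b : Fin m → EuclideanSpace ℝ (Fin n)) : ℝ := sigmaMin (linearPart b)

/-- `L_new = √(λ_max(∑ A_iᵀ A_i))`. -/
def Lnew {n m : ℕ} (A : Fin m → Matrix (Fin n) (Fin n) ℝ) : ℝ :=
  √(lambdaMax (∑ i, (A i)ᵀ * A i))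

/-- `ε*_new = ν / (2 L_new)`, with values in `[0, ∞]`: it is `∞` if `L_new = 0 < ν`. -/
def epsStar {n m : ℕ} (A : Fin m → Matrix (Fin n) (Fin n) ℝ)
    (b : Fin m → EuclideanSpace ℝ (Fin n)) : ℝ≥0∞ :=
  ENNReal.ofReal (nu b) / ENNReal.ofReal (2 * Lnew A)

end QuadMap

end

/-!
On the ball `B(a, ε)` the map `f(x) = ½ β(x, x) + D x` differs from its linear part `D` by a
Lipschitz map of constant `‖β‖ (‖a‖ + ε)`, and `D` has a right inverse of norm at most `ν⁻¹`. Hence,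
by the inverse function theorem in its quantitative form, `f` maps every ball `B(z, ρ) ⊆ B(a, ε)`
onto a set containing `B(f(z), (ν - ‖β‖ (‖a‖ + ε)) ρ)`.

Let `z = s x + t y` be a convex combination of points of `B(a, ε)` and let `ρ = ε - ‖z - a‖`. The
point `s f(x) + t f(y)` of the chord lies at distance `(s t / 2) ‖β(x - y, x - y)‖` from `f(z)`.
Strong convexity of `‖·‖²` gives `s t ‖x - y‖² ≤ ε² - ‖z - a‖² ≤ 2 ε ρ`, so this distance is at most
`‖β‖ ε ρ`, and the chord stays in the image as soon as `‖β‖ (‖a‖ + 2 ε) ≤ ν`.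
-/

namespace QuadMap

open Metric Set
open scoped InnerProductSpace NNReal MatrixOrder

section NormedSpace

variable {E F : Type*} [NormedAddCommGroup E] [NormedSpace ℝ E]
  [NormedAddCommGroup F] [NormedSpace ℝ F]

/-- The quadratic map `x ↦ ½ β(x, x) + D x` between normed spaces. The bilinear map `β` is not
assumed symmetric, just as the matrices `A_i` of `quadMap` are not. -/
noncomputable def bilinQuadMap (β : E →L[ℝ] E →L[ℝ] F) (D : E →L[ℝ] F) (x : E) : F :=
  (1 / 2 : ℝ) • β x x + D x

lemma bilinQuadMap_convexCombo (β : E →L[ℝ] E →L[ℝ] F) (D : E →L[ℝ] F) (x y : E) {s t : ℝ}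
    (hst : s + t = 1) :
    s • bilinQuadMap β D x + t • bilinQuadMap β D y - bilinQuadMap β D (s • x + t • y) =
      (s * t / 2) • β (x - y) (x - y) := by
  obtain rfl : s = 1 - t := eq_sub_of_add_eq hst
  simp only [bilinQuadMap, map_add, map_sub, map_smul, add_apply, sub_apply, smul_apply]
  module

lemma norm_bilinQuadMap_convexCombo_le (β : E →L[ℝ] E →L[ℝ] F) (D : E →L[ℝ] F) (x y : E)
    {s t : ℝ} (hs : 0 ≤ s) (ht : 0 ≤ t) (hst : s + t = 1) :
    ‖s • bilinQuadMap β D x + t • bilinQuadMap β D y - bilinQuadMap β D (s • x + t • y)‖ ≤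
      ‖β‖ / 2 * (s * t * ‖x - y‖ ^ 2) := by
  rw [bilinQuadMap_convexCombo β D x y hst, norm_smul, Real.norm_of_nonneg (by positivity)]
  calc s * t / 2 * ‖β (x - y) (x - y)‖
      ≤ s * t / 2 * (‖β‖ * ‖x - y‖ * ‖x - y‖) := by gcongr; exact β.le_opNorm₂ _ _
    _ = ‖β‖ / 2 * (s * t * ‖x - y‖ ^ 2) := by ring

lemma approximatesLinearOn_bilinQuadMap (β : E →L[ℝ] E →L[ℝ] F) (D : E →L[ℝ] F) (r : ℝ≥0) :
    ApproximatesLinearOn (bilinQuadMap β D) D (closedBall 0 r) (‖β‖₊ * r) := by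
  intro x hx y hy
  rw [mem_closedBall_zero_iff] at hx hy
  have hdiff : bilinQuadMap β D x - bilinQuadMap β D y - D (x - y) =
      (1 / 2 : ℝ) • (β x (x - y) + β (x - y) y) := by
    simp only [bilinQuadMap, map_sub, sub_apply]
    module
  rw [hdiff, norm_smul, Real.norm_of_nonneg (by positivity)]
  calc 1 / 2 * ‖β x (x - y) + β (x - y) y‖
      ≤ 1 / 2 * (‖β‖ * ‖x‖ * ‖x - y‖ + ‖β‖ * ‖x - y‖ * ‖y‖) := by
        gcongr
        exact norm_add_le_of_le (β.le_opNorm₂ _ _) (β.le_opNorm₂ _ _)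
    _ ≤ 1 / 2 * (‖β‖ * r * ‖x - y‖ + ‖β‖ * ‖x - y‖ * r) := by gcongr
    _ = ↑(‖β‖₊ * r) * ‖x - y‖ := by push_cast; ring

end NormedSpace

section ConvexityPrinciple

variable {E F : Type*} [NormedAddCommGroup E] [InnerProductSpace ℝ E]

lemma strongConvexOn_norm_sq : StrongConvexOn univ 2 fun x : E => ‖x‖ ^ 2 := by
  rw [strongConvexOn_iff_convex]
  simpa using convexOn_const (0 : ℝ) (convex_univ (𝕜 := ℝ) (E := E))

lemma mul_norm_sub_sq_le_of_mem_closedBall {a x y : E} {ε s t : ℝ} (hx : x ∈ closedBall a ε)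
    (hy : y ∈ closedBall a ε) (hs : 0 ≤ s) (ht : 0 ≤ t) (hst : s + t = 1) :
    s * t * ‖x - y‖ ^ 2 ≤ 2 * ε * (ε - ‖s • x + t • y - a‖) := by
  rw [mem_closedBall_iff_norm] at hx hy
  have hcombo : s • (x - a) + t • (y - a) = s • x + t • y - a := by
    obtain rfl : s = 1 - t := eq_sub_of_add_eq hst
    module
  have hstrong := strongConvexOn_norm_sq.2 (mem_univ (x - a)) (mem_univ (y - a)) hs ht hst
  simp only [hcombo, sub_sub_sub_cancel_right, smul_eq_mul] at hstrong
  have hle : s * ‖x - a‖ ^ 2 + t * ‖y - a‖ ^ 2 ≤ ε ^ 2 :=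
    calc s * ‖x - a‖ ^ 2 + t * ‖y - a‖ ^ 2 ≤ s * ε ^ 2 + t * ε ^ 2 := by gcongr
      _ = ε ^ 2 := by rw [← add_mul, hst, one_mul]
  calc s * t * ‖x - y‖ ^ 2 ≤ ε ^ 2 - ‖s • x + t • y - a‖ ^ 2 := by linarith
    _ ≤ 2 * ε * (ε - ‖s • x + t • y - a‖) := by
      linarith [sq_nonneg (ε - ‖s • x + t • y - a‖)]

variable [CompleteSpace E] [NormedAddCommGroup F] [NormedSpace ℝ F]

theorem convex_image_closedBall_of_approximatesLinearOn {f : E → F} {D : E →L[ℝ] F} {a : E}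
    {ε L : ℝ} {c : ℝ≥0} (hf : ApproximatesLinearOn f D (closedBall a ε) c)
    (R : D.NonlinearRightInverse) (hL : 0 ≤ L)
    (hdefect : ∀ x ∈ closedBall a ε, ∀ y ∈ closedBall a ε, ∀ s t : ℝ, 0 ≤ s → 0 ≤ t → s + t = 1 →
      ‖s • f x + t • f y - f (s • x + t • y)‖ ≤ L / 2 * (s * t * ‖x - y‖ ^ 2))
    (hLc : L * ε + c ≤ (R.nnnorm : ℝ)⁻¹) :
    Convex ℝ (f '' closedBall a ε) := by
  rintro _ ⟨x, hx, rfl⟩ _ ⟨y, hy, rfl⟩ s t hs ht hst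
  set z := s • x + t • y
  set ρ := ε - ‖z - a‖
  have hρ : 0 ≤ ρ :=
    sub_nonneg.2 (mem_closedBall_iff_norm.1 (convex_closedBall a ε hx hy hs ht hst))
  have hsub : closedBall z ρ ⊆ closedBall a ε :=
    closedBall_subset_closedBall' (by rw [dist_eq_norm, sub_add_cancel])
  have hmem : s • f x + t • f y ∈ closedBall (f z) (((R.nnnorm : ℝ)⁻¹ - c) * ρ) := by
    rw [mem_closedBall_iff_norm]
    calc ‖s • f x + t • f y - f z‖ ≤ L / 2 * (s * t * ‖x - y‖ ^ 2) :=
          hdefect x hx y hy s t hs ht hst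
      _ ≤ L / 2 * (2 * ε * ρ) :=
          mul_le_mul_of_nonneg_left (mul_norm_sub_sq_le_of_mem_closedBall hx hy hs ht hst)
            (by positivity)
      _ = L * ε * ρ := by ring
      _ ≤ ((R.nnnorm : ℝ)⁻¹ - c) * ρ := by gcongr; exact le_sub_iff_add_le.2 hLc
  exact image_mono hsub (hf.surjOn_closedBall_of_nonlinearRightInverse R hρ hsub hmem)

end ConvexityPrinciple

section Hilbert

variable {E F : Type*} [NormedAddCommGroup E] [InnerProductSpace ℝ E] [CompleteSpace E]
  [NormedAddCommGroup F] [InnerProductSpace ℝ F] [CompleteSpace F]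

lemma exists_nonlinearRightInverse_of_le_norm_adjoint (T : E →L[ℝ] F) {ν : ℝ≥0} (hν : 0 < ν)
    (hT : ∀ y, ν * ‖y‖ ≤ ‖T.adjoint y‖) :
    ∃ R : T.NonlinearRightInverse, R.nnnorm = ν⁻¹ := by
  have hinner (y : F) : ⟪(T ∘L T.adjoint) y, y⟫_ℝ = ‖T.adjoint y‖ ^ 2 := by
    rw [ContinuousLinearMap.comp_apply, ← ContinuousLinearMap.adjoint_inner_right,
      real_inner_self_eq_norm_sq]
  have hunit : IsUnit (T ∘L T.adjoint) := by
    refine ContinuousLinearMap.isUnit_of_forall_le_norm_inner_map _ (c := ν ^ 2) (by positivity)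
      fun y => ?_
    rw [hinner, Real.norm_of_nonneg (by positivity), NNReal.coe_pow, mul_comm, ← mul_pow]
    gcongr
    exact hT y
  have hsurj : Function.Surjective (T ∘L T.adjoint) :=
    (ContinuousLinearMap.isUnit_iff_bijective.1 hunit).2
  choose g hg using hsurj
  refine ⟨⟨fun w => T.adjoint (g w), ν⁻¹, fun w => ?_, hg⟩, rfl⟩
  have hsq : ‖T.adjoint (g w)‖ ^ 2 ≤ ‖w‖ * ‖g w‖ := by
    rw [← hinner, hg]
    exact real_inner_le_norm _ _
  rw [NNReal.coe_inv, ← div_eq_inv_mul, le_div_iff₀ (by positivity)]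
  rcases (norm_nonneg (T.adjoint (g w))).eq_or_lt with hzero | hpos
  · rw [← hzero, zero_mul]
    exact norm_nonneg w
  · refine le_of_mul_le_mul_right ?_ hpos
    calc ‖T.adjoint (g w)‖ * ν * ‖T.adjoint (g w)‖ = ν * ‖T.adjoint (g w)‖ ^ 2 := by ring
      _ ≤ ν * (‖w‖ * ‖g w‖) := by gcongr
      _ = ‖w‖ * (ν * ‖g w‖) := by ring
      _ ≤ ‖w‖ * ‖T.adjoint (g w)‖ := by gcongr; exact hT (g w)

end Hilbert

section Spectrum

variable {ι : Type*} [Fintype ι] [DecidableEq ι]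

lemma inner_toEuclideanLin_mono {M N : Matrix ι ι ℝ} (h : M ≤ N) (y : EuclideanSpace ℝ ι) :
    ⟪y, M.toEuclideanLin y⟫_ℝ ≤ ⟪y, N.toEuclideanLin y⟫_ℝ := by
  have hpos := (Matrix.isPositive_toEuclideanLin_iff.2 (Matrix.le_iff.1 h)).re_inner_nonneg_right y
  simpa only [map_sub, LinearMap.sub_apply, inner_sub_right, RCLike.re_to_real, sub_nonneg]
    using hpos

lemma inner_toEuclideanLin_algebraMap (c : ℝ) (y : EuclideanSpace ℝ ι) :
    ⟪y, (algebraMap ℝ (Matrix ι ι ℝ) c).toEuclideanLin y⟫_ℝ = c * ‖y‖ ^ 2 := by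
  simp [Algebra.algebraMap_eq_smul_one, inner_smul_right]

lemma lambdaMin_mul_norm_sq_le_inner {k : ℕ} {M : Matrix (Fin k) (Fin k) ℝ} (hM : M.IsHermitian)
    (y : EuclideanSpace ℝ (Fin k)) : lambdaMin M * ‖y‖ ^ 2 ≤ ⟪y, M.toEuclideanLin y⟫_ℝ := by
  rw [← inner_toEuclideanLin_algebraMap]
  exact inner_toEuclideanLin_mono (algebraMap_le_of_le_spectrum
    (fun _ hr => csInf_le M.finite_real_spectrum.bddBelow hr) hM) y

lemma inner_le_lambdaMax_mul_norm_sq {k : ℕ} {M : Matrix (Fin k) (Fin k) ℝ} (hM : M.IsHermitian)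
    (y : EuclideanSpace ℝ (Fin k)) : ⟪y, M.toEuclideanLin y⟫_ℝ ≤ lambdaMax M * ‖y‖ ^ 2 := by
  rw [← inner_toEuclideanLin_algebraMap]
  exact inner_toEuclideanLin_mono (le_algebraMap_of_spectrum_le
    (fun _ hr => le_csSup M.finite_real_spectrum.bddAbove hr) hM) y

lemma inner_toEuclideanLin_transpose_mul_self {κ : Type*} [Fintype κ]
    (B : Matrix κ ι ℝ) (y : EuclideanSpace ℝ ι) :
    ⟪y, (Bᵀ * B).toEuclideanLin y⟫_ℝ = ‖B.toEuclideanLin y‖ ^ 2 := by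
  classical
  rw [Matrix.toLpLin_mul_same, LinearMap.comp_apply, ← Matrix.conjTranspose_eq_transpose_of_trivial,
    Matrix.toEuclideanLin_conjTranspose_eq_adjoint, LinearMap.adjoint_inner_right,
    real_inner_self_eq_norm_sq]

end Spectrum

section Matrices

variable {n m : ℕ}

lemma isHermitian_transpose_mul_self {ι κ : Type*} [Fintype κ] (B : Matrix κ ι ℝ) :
    (Bᵀ * B).IsHermitian := by
  simpa only [Matrix.conjTranspose_eq_transpose_of_trivial] using
    Matrix.isHermitian_conjTranspose_mul_self B

lemma sigmaMin_mul_norm_le (B : Matrix (Fin n) (Fin m) ℝ) (y : EuclideanSpace ℝ (Fin m)) :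
    sigmaMin B * ‖y‖ ≤ ‖B.toEuclideanLin y‖ := by
  rw [sigmaMin, ← Real.sqrt_sq (norm_nonneg y), ← Real.sqrt_mul' _ (sq_nonneg _)]
  refine Real.sqrt_le_iff.2 ⟨norm_nonneg _, ?_⟩
  rw [← inner_toEuclideanLin_transpose_mul_self]
  exact lambdaMin_mul_norm_sq_le_inner (isHermitian_transpose_mul_self B) y

lemma sum_norm_toEuclideanLin_sq_le (A : Fin m → Matrix (Fin n) (Fin n) ℝ)
    (y : EuclideanSpace ℝ (Fin n)) :
    ∑ i, ‖(A i).toEuclideanLin y‖ ^ 2 ≤ (Lnew A * ‖y‖) ^ 2 := by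
  have hM : (∑ i, (A i)ᵀ * A i).IsHermitian :=
    isSelfAdjoint_sum _ fun i _ => isHermitian_transpose_mul_self (A i)
  calc ∑ i, ‖(A i).toEuclideanLin y‖ ^ 2
      = ⟪y, (∑ i, (A i)ᵀ * A i).toEuclideanLin y⟫_ℝ := by
        simp only [map_sum, LinearMap.sum_apply, inner_sum,
          inner_toEuclideanLin_transpose_mul_self]
    _ ≤ lambdaMax (∑ i, (A i)ᵀ * A i) * ‖y‖ ^ 2 := inner_le_lambdaMax_mul_norm_sq hM y
    _ ≤ Lnew A ^ 2 * ‖y‖ ^ 2 := by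
        gcongr
        exact (Real.sqrt_le_left (Real.sqrt_nonneg _)).1 le_rfl
    _ = (Lnew A * ‖y‖) ^ 2 := (mul_pow _ _ _).symm

/-- The bilinear map `(x, y) ↦ (xᵀ A_i y)_i`, whose diagonal is twice the quadratic part of
`quadMap`. -/
noncomputable def quadBilin (A : Fin m → Matrix (Fin n) (Fin n) ℝ) :
    EuclideanSpace ℝ (Fin n) →L[ℝ] EuclideanSpace ℝ (Fin n) →L[ℝ] EuclideanSpace ℝ (Fin m) :=
  LinearMap.toContinuousBilinearMap <|
    LinearMap.mk₂ ℝ (fun x y => WithLp.toLp 2 fun i => x.ofLp ⬝ᵥ (A i *ᵥ y.ofLp))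
      (fun x x' y => by ext i; simp [add_dotProduct])
      (fun c x y => by ext i; simp)
      (fun x y y' => by ext i; simp [Matrix.mulVec_add, dotProduct_add])
      (fun c x y => by ext i; simp [Matrix.mulVec_smul])

lemma quadBilin_apply (A : Fin m → Matrix (Fin n) (Fin n) ℝ) (x y : EuclideanSpace ℝ (Fin n))
    (i : Fin m) : quadBilin A x y i = ⟪(A i).toEuclideanLin y, x⟫_ℝ :=
  rfl

lemma norm_quadBilin_le (A : Fin m → Matrix (Fin n) (Fin n) ℝ) : ‖quadBilin A‖ ≤ Lnew A := by
  have hL : 0 ≤ Lnew A := Real.sqrt_nonneg _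
  refine ContinuousLinearMap.opNorm_le_bound₂ _ hL fun x y => ?_
  refine le_of_sq_le_sq ?_ (by positivity)
  calc ‖quadBilin A x y‖ ^ 2 = ∑ i, ⟪(A i).toEuclideanLin y, x⟫_ℝ ^ 2 := by
        simp only [EuclideanSpace.real_norm_sq_eq, quadBilin_apply]
    _ ≤ ∑ i, (‖(A i).toEuclideanLin y‖ * ‖x‖) ^ 2 :=
        Finset.sum_le_sum fun i _ =>
          sq_le_sq' (neg_le_of_abs_le (abs_real_inner_le_norm _ _)) (real_inner_le_norm _ _)
    _ = (∑ i, ‖(A i).toEuclideanLin y‖ ^ 2) * ‖x‖ ^ 2 := by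
        simp only [mul_pow, Finset.sum_mul]
    _ ≤ (Lnew A * ‖y‖) ^ 2 * ‖x‖ ^ 2 := by gcongr; exact sum_norm_toEuclideanLin_sq_le A y
    _ = (Lnew A * ‖x‖ * ‖y‖) ^ 2 := by ring

/-- The linear part `x ↦ (a_iᵀ x)_i` of `quadMap`. -/
noncomputable def linearPartCLM (b : Fin m → EuclideanSpace ℝ (Fin n)) :
    EuclideanSpace ℝ (Fin n) →L[ℝ] EuclideanSpace ℝ (Fin m) :=
  (linearPart b)ᵀ.toEuclideanLin.toContinuousLinearMap

lemma nu_mul_norm_le (b : Fin m → EuclideanSpace ℝ (Fin n)) (y : EuclideanSpace ℝ (Fin m)) :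
    nu b * ‖y‖ ≤ ‖(linearPartCLM b).adjoint y‖ := by
  have hadj : (linearPartCLM b).adjoint =
      (linearPart b).toEuclideanLin.toContinuousLinearMap := by
    rw [linearPartCLM, ← LinearMap.adjoint_toContinuousLinearMap,
      ← Matrix.toEuclideanLin_conjTranspose_eq_adjoint,
      Matrix.conjTranspose_eq_transpose_of_trivial, Matrix.transpose_transpose]
  rw [hadj]
  exact sigmaMin_mul_norm_le (linearPart b) y

lemma quadMap_eq_bilinQuadMap (A : Fin m → Matrix (Fin n) (Fin n) ℝ)
    (b : Fin m → EuclideanSpace ℝ (Fin n)) :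
    quadMap A b = bilinQuadMap (quadBilin A) (linearPartCLM b) :=
  rfl

lemma Lnew_mul_lt_nu {A : Fin m → Matrix (Fin n) (Fin n) ℝ} {b : Fin m → EuclideanSpace ℝ (Fin n)}
    {ε r : ℝ} (hε : 0 ≤ ε) (hr : 0 ≤ r)
    (h : ENNReal.ofReal r < 2 * (epsStar A b - ENNReal.ofReal ε)) :
    Lnew A * (r + 2 * ε) < nu b := by
  have hdiv : ENNReal.ofReal (r / 2 + ε) < epsStar A b := by
    rw [ENNReal.ofReal_add (by positivity) hε, ENNReal.ofReal_div_of_pos two_pos,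
      ENNReal.ofReal_ofNat]
    exact lt_tsub_iff_right.1 (ENNReal.div_lt_of_lt_mul' h)
  have hmul := ENNReal.mul_lt_of_lt_div hdiv
  rw [← ENNReal.ofReal_mul (by positivity), ENNReal.ofReal_lt_ofReal_iff'] at hmul
  linarith [hmul.1]

lemma norm_quadBilin_mul_lt_nu {A : Fin m → Matrix (Fin n) (Fin n) ℝ}
    {b : Fin m → EuclideanSpace ℝ (Fin n)} {ε r : ℝ} (hε : 0 ≤ ε) (hr : 0 ≤ r)
    (h : ENNReal.ofReal r < 2 * (epsStar A b - ENNReal.ofReal ε)) :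
    ‖quadBilin A‖ * (r + 2 * ε) < nu b :=
  (mul_le_mul_of_nonneg_right (norm_quadBilin_le A) (by positivity)).trans_lt
    (Lnew_mul_lt_nu hε hr h)

end Matrices

end QuadMap

theorem theorem3_general {E F : Type*} [NormedAddCommGroup E] [InnerProductSpace ℝ E]
    [CompleteSpace E] [NormedAddCommGroup F] [InnerProductSpace ℝ F] [CompleteSpace F]
    (β : E →L[ℝ] E →L[ℝ] F) (D : E →L[ℝ] F) {ν ε : ℝ} (hν : 0 < ν)
    (hD : ∀ y, ν * ‖y‖ ≤ ‖D.adjoint y‖) (a : E) (h : ‖β‖ * (‖a‖ + 2 * ε) ≤ ν) :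
    Convex ℝ (QuadMap.bilinQuadMap β D '' Metric.closedBall a ε) := by
  rcases lt_or_ge ε 0 with hε | hε
  · rw [Metric.closedBall_eq_empty.2 hε, Set.image_empty]
    exact convex_empty
  lift ν to NNReal using hν.le
  lift ε to NNReal using hε
  obtain ⟨R, hR⟩ := QuadMap.exists_nonlinearRightInverse_of_le_norm_adjoint D
    (NNReal.coe_pos.1 hν) hD
  have hball : Metric.closedBall a (ε : ℝ) ⊆ Metric.closedBall 0 (‖a‖₊ + ε : NNReal) :=
    Metric.closedBall_subset_closedBall' (by rw [dist_zero_right]; push_cast; linarith)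
  refine QuadMap.convex_image_closedBall_of_approximatesLinearOn
    ((QuadMap.approximatesLinearOn_bilinQuadMap β D _).mono_set hball) R (norm_nonneg β)
    (fun x _ y _ s t => QuadMap.norm_bilinQuadMap_convexCombo_le β D x y) ?_
  rw [hR]
  push_cast
  rw [inv_inv]
  linarith

theorem theorem3 {n m : ℕ} (A : Fin m → Matrix (Fin n) (Fin n) ℝ)
    (b : Fin m → EuclideanSpace ℝ (Fin n)) (ε : ℝ) (hε : 0 < ε)
    (hε' : ENNReal.ofReal ε < QuadMap.epsStar A b)
    (a : EuclideanSpace ℝ (Fin n))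
    (ha : ENNReal.ofReal ‖a‖ < 2 * (QuadMap.epsStar A b - ENNReal.ofReal ε)) :
    Convex ℝ {y : EuclideanSpace ℝ (Fin m) |
      ∃ x : EuclideanSpace ℝ (Fin n), ‖x - a‖ ≤ ε ∧ QuadMap.quadMap A b x = y} := by
  have hlt := QuadMap.norm_quadBilin_mul_lt_nu hε.le (norm_nonneg a) ha
  simp only [← mem_closedBall_iff_norm, QuadMap.quadMap_eq_bilinQuadMap]
  exact theorem3_general _ _ (lt_of_le_of_lt (by positivity) hlt)
    (QuadMap.nu_mul_norm_le b) a hlt.le
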